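/- Let $n\ge 3$ and let $L\cong\mathbf 2^n$ be a Boolean lattice with $n$ atoms. Let $L^B$ be a blow-up of $L$ by finite chains: each $x\in L$ is replaced by a nonempty finite chain $C_x$ (of arbitrary size for $x\neq 0,1$, and of size one for $x=0,1$), and for $a\in C_x$, $b\in C_y$ one has $a\le b$ in $L^B$ iff $x<y$ in $L$, or $x=y$ and $a\le b$ in $C_x$. For $a\in L^B$ let $a^\perp=\{b : \text{the only common lower bound of } a \text{ and } b \text{ is } 0\}$ and let $[a]=\{b\in L^B: b^\perp=a^\perp\}$; let $m$ be the number of atoms $q$ of $L^B$ with $|[q]|=1$. Let $Z^*(L^B)$ be the set of nonzero $a\in L^B$ such that $0$ is the only common lower bound of $a$ and some $b\ne 0$, and let the zero-divisor graph $G(L^B)$ have vertex set $Z^*(L^B)$, two distinct vertices being adjacent iff their only common lower bound is $0$. The strong metric dimension $\operatorname{sdim}_M(G)$ of a finite connected graph $G$ is the smallest cardinality of a set $W$ of vertices such that for any two distinct vertices $u,v$ there is $w\in W$ for which $v$ lies on a shortest path from $u$ to $w$ or $u$ lies on a shortest path from $v$ to $w$. Then, whatever the value of $m$, $$\operatorname{sdim}_M(G(L^B))=|Z^*(L^B)|-2n+2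 .$$ -/

import Mathlib

section PosetGraph

variable {P : Type*} [PartialOrder P] [OrderBot P]

/-- The annihilator `a^⊥` of an element of a poset with `0`: all `b` whose only common lower bound
with `a` is `0`. -/
def annihilator (a : P) : Set P := {b | lowerBounds {a, b} = {⊥}}

/-- The class `[a]` of `a` under `x ∼ y ↔ x^⊥ = y^⊥`. -/
def annihilatorClass (a : P) : Set P := {b | annihilator b = annihilator a}

variable (P) in
/-- The set `Z(P)` of zero-divisors of `P`. -/
def zeroDivisors : Set P := {a | ∃ b : P, b ≠ ⊥ ∧ lowerBounds {a, b} = {⊥}}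

variable (P) in
/-- The set `Z*(P)` of nonzero zero-divisors of `P`. -/
def nonzeroZeroDivisors : Set P := zeroDivisors P \ {⊥}

variable (P) in
/-- The zero-divisor graph `G(P)`: its vertices are the nonzero zero-divisors, two of them being
adjacent when their only common lower bound is `0`. -/
def zeroDivisorGraph : SimpleGraph (nonzeroZeroDivisors P) where
  Adj a b := lowerBounds {(a : P), (b : P)} = {⊥}
  symm := ⟨fun a b h => by rwa [Set.pair_comm]⟩
  loopless := ⟨fun a h => a.2.2 (by
    have ha : (a : P) ∈ lowerBounds {(a : P), (a : P)} := by simp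
    rw [h] at ha
    exact ha)⟩

end PosetGraph

section StrongMetricDimension

variable {V : Type*}

/-- `v` lies on some shortest path from `u` to `w`. -/
def OnShortestPath (G : SimpleGraph V) (u w v : V) : Prop :=
  ∃ p : G.Walk u w, p.IsPath ∧ p.length = G.dist u w ∧ v ∈ p.support

/-- `w` strongly resolves `u` and `v`. -/
def StronglyResolves (G : SimpleGraph V) (w u v : V) : Prop :=
  OnShortestPath G u w v ∨ OnShortestPath G v w u

/-- Every pair of (distinct) vertices is strongly resolved by some vertex of `W`. -/
def IsStrongResolvingSet (G : SimpleGraph V) (W : Finset V) : Prop :=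
  ∀ u v : V, u ≠ v → ∃ w ∈ W, StronglyResolves G w u v

/-- The strong metric dimension: the smallest cardinality of a (finite) strong resolving set. -/
noncomputable def strongMetricDim (G : SimpleGraph V) : ℕ :=
  sInf {k | ∃ W : Finset V, IsStrongResolvingSet G W ∧ W.card = k}

end StrongMetricDimension

section Blowup

variable {L : Type*} [PartialOrder L] [BoundedOrder L]

variable (L) in
/-- The data of a blow-up of a bounded poset by finite nonempty chains: the number of elements of
the chain that replaces each element. The elements `0` and `1` are not enlarged. -/
structure ChainSizes where
  size : L → ℕ
  size_pos : ∀ x, 0 < size x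
  size_bot : size ⊥ = 1
  size_top : size ⊤ = 1

/-- The blow-up: each `x` is replaced by a chain with `k.size x` elements. The order is the
lexicographic one: `(x, i) ≤ (y, j)` iff `x < y`, or `x = y` and `i ≤ j`. -/
def Blowup (k : ChainSizes L) : Type _ := Σₗ x : L, Fin (k.size x)

instance (k : ChainSizes L) : PartialOrder (Blowup k) :=
  inferInstanceAs (PartialOrder (Σₗ x : L, Fin (k.size x)))

/-- The element at position `i` of the chain that replaces `x`. -/
def Blowup.mk {k : ChainSizes L} (x : L) (i : Fin (k.size x)) : Blowup k := toLex ⟨x, i⟩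

theorem Blowup.mk_le_mk_iff {k : ChainSizes L} {x y : L} {i : Fin (k.size x)}
    {j : Fin (k.size y)} :
    (Blowup.mk x i : Blowup k) ≤ Blowup.mk y j ↔ x < y ∨ (x = y ∧ (i : ℕ) ≤ (j : ℕ)) := by
  refine (Sigma.Lex.le_def (a := (⟨x, i⟩ : Σₗ x : L, Fin (k.size x))) (b := ⟨y, j⟩)).trans ?_
  refine or_congr Iff.rfl ⟨?_, ?_⟩
  · rintro ⟨h, hij⟩
    dsimp at h
    subst h
    exact ⟨rfl, hij⟩
  · rintro ⟨h, hij⟩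
    subst h
    exact ⟨rfl, hij⟩

instance (k : ChainSizes L) : OrderBot (Blowup k) where
  bot := Blowup.mk ⊥ ⟨0, k.size_pos ⊥⟩
  bot_le := by
    rintro ⟨y, j⟩
    refine Blowup.mk_le_mk_iff.2 ?_
    rcases (bot_le : ⊥ ≤ y).eq_or_lt with h | h
    · exact Or.inr ⟨h, Nat.zero_le _⟩
    · exact Or.inl h

end Blowup

/-! ### Laminar families of finite sets -/

/-! Adjacency of two vertices depends only on their bases in `L`, namely on whether these are
disjoint, and distances are at most 3. Suppose two vertices avoid a strong resolving set `W`. The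
`w` resolving them differs from both, so one of them is a non-final vertex on a shortest path from
the other to `w`; this forces distinct bases that are disjoint or comparable
(`IsStrongResolvingSet.disjoint_or_le`). Hence `Wᶜ` injects into a laminar family of nonempty proper
subsets of an `n`-set. Together with the whole set, such a family has at most `2n - 1` members
(`IsLaminar.card_add_one_le`), so `Wᶜ` has at most `2n - 2`. Conversely, take a laminar family of
`2n - 1` nonempty sets, drop the whole set, and leave out of `W` one vertex over each remaining
member. Pairs left out are resolved by complements, which laminarity keeps outside the family
(`IsLaminar.compl_notMem`, `exists_stronglyResolves`). -/

/-- A family of elements of an order is laminar when any two of them are disjoint or comparable. -/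
def IsLaminar {α : Type*} [PartialOrder α] [OrderBot α] (F : Set α) : Prop :=
  ∀ x ∈ F, ∀ y ∈ F, Disjoint x y ∨ x ≤ y ∨ y ≤ x

theorem IsLaminar.subset {α : Type*} [PartialOrder α] [OrderBot α] {F F' : Set α}
    (h : IsLaminar F) (hs : F' ⊆ F) : IsLaminar F' :=
  fun x hx y hy => h x (hs hx) y (hs hy)

/-- Let `M` be maximal among the members other than `A`. Every member except possibly `A` lies in
`M` or in `A \ M`, so induction gives at most `(2|M| - 1) + (2|A \ M| - 1) + 1 = 2|A| - 1`. -/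
theorem IsLaminar.card_add_one_le {α : Type*} [DecidableEq α] (A : Finset α) (hA : A.Nonempty)
    (F : Finset (Finset α)) (hF : IsLaminar (F : Set (Finset α)))
    (hsub : ∀ x ∈ F, x.Nonempty ∧ x ⊆ A) : F.card + 1 ≤ 2 * A.card := by
  induction A using Finset.strongInduction generalizing F with
  | H A ih =>
  have hA1 : 1 ≤ A.card := hA.card_pos
  by_cases hne : (F.erase A).Nonempty
  · obtain ⟨M, hM, hmax⟩ := (F.erase A).exists_maximal hne
    rw [Finset.mem_erase] at hM
    have hMA : M ⊂ A := (hsub M hM.2).2.ssubset_of_ne hM.1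
    have h1 := ih M hMA (hsub M hM.2).1 (F.filter (· ⊆ M))
      (hF.subset (by intro x hx; simp at hx; exact hx.1))
      (fun x hx => by
        rw [Finset.mem_filter] at hx
        exact ⟨(hsub x hx.1).1, hx.2⟩)
    have hcompl : A \ M ⊂ A := Finset.sdiff_ssubset hMA.1 (hsub M hM.2).1
    have h2 := ih (A \ M) hcompl (Finset.sdiff_nonempty.2 hMA.2) (F.filter (· ⊆ A \ M))
      (hF.subset (by intro x hx; simp at hx; exact hx.1))
      (fun x hx => by
        rw [Finset.mem_filter] at hx
        exact ⟨(hsub x hx.1).1, hx.2⟩)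
    have hcover : F ⊆ insert A (F.filter (· ⊆ M) ∪ F.filter (· ⊆ A \ M)) := by
      intro x hx
      by_cases hxA : x = A
      · simp [hxA]
      · simp only [Finset.mem_insert, Finset.mem_union, Finset.mem_filter]
        rcases hF x hx M hM.2 with h | h | h
        · exact Or.inr (Or.inr ⟨hx, Finset.subset_sdiff.2 ⟨(hsub x hx).2, h⟩⟩)
        · exact Or.inr (Or.inl ⟨hx, h⟩)
        · exact Or.inr (Or.inl ⟨hx, hmax (Finset.mem_erase.2 ⟨hxA, hx⟩) h⟩)
    have h3 := (Finset.card_le_card hcover).trans (Finset.card_insert_le _ _)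
    have h4 := Finset.card_union_le (F.filter (· ⊆ M)) (F.filter (· ⊆ A \ M))
    have h5 := Finset.card_sdiff_add_card_eq_card hMA.1
    omega
  · have h0 : (F.erase A).card = 0 := by
      rw [Finset.card_eq_zero]; exact Finset.not_nonempty_iff_eq_empty.1 hne
    have := Finset.pred_card_le_card_erase (s := F) (a := A)
    omega

/-- Each new point `a` contributes two sets: the singleton `{a}` and the enlarged ground set. -/
theorem exists_isLaminar_card {α : Type*} [DecidableEq α] (A : Finset α) (hA : A.Nonempty) :
    ∃ F : Finset (Finset α), IsLaminar (F : Set (Finset α)) ∧ (∀ x ∈ F, x.Nonempty ∧ x ⊆ A) ∧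
      F.card + 1 = 2 * A.card := by
  induction hA using Finset.Nonempty.cons_induction with
  | singleton a =>
    refine ⟨{{a}}, ?_, by simp, by simp⟩
    intro x hx y hy
    simp only [Finset.coe_singleton, Set.mem_singleton_iff] at hx hy
    exact Or.inr (Or.inl (hx.trans hy.symm).le)
  | cons a s ha hs ih =>
    obtain ⟨F, hF, hsub, hcard⟩ := ih
    have hnot : ∀ x ∈ F, a ∉ x := fun x hx hax => ha ((hsub x hx).2 hax)
    have h1 : insert a s ∉ F := fun h => hnot _ h (Finset.mem_insert_self a s)
    have h2 : {a} ∉ insert (insert a s) F := by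
      rw [Finset.mem_insert, not_or]
      refine ⟨fun h => ?_, fun h => hnot _ h (Finset.mem_singleton_self a)⟩
      obtain ⟨b, hb⟩ := hs
      have hb' : b ∈ ({a} : Finset α) := h ▸ Finset.mem_insert_of_mem hb
      rw [Finset.mem_singleton] at hb'
      exact ha (hb' ▸ hb)
    refine ⟨insert {a} (insert (insert a s) F), ?_, ?_, ?_⟩
    · have hle : ∀ x ∈ insert {a} (insert (insert a s) F), x ≤ insert a s := by
        intro x hx
        rw [Finset.mem_insert, Finset.mem_insert] at hx
        rcases hx with rfl | rfl | hx
        · simp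
        · exact le_rfl
        · exact (hsub x hx).2.trans (Finset.subset_insert a s)
      intro x hx y hy
      have hxle := hle x hx
      have hyle := hle y hy
      simp only [Finset.coe_insert, Set.mem_insert_iff, Finset.mem_coe] at hx hy
      rcases hx with rfl | rfl | hx
      · rcases hy with rfl | rfl | hy
        · exact Or.inr (Or.inl le_rfl)
        · exact Or.inr (Or.inl hxle)
        · exact Or.inl (Finset.disjoint_singleton_left.2 (hnot y hy))
      · exact Or.inr (Or.inr hyle)
      · rcases hy with rfl | rfl | hy
        · exact Or.inl (Finset.disjoint_singleton_right.2 (hnot x hx))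
        · exact Or.inr (Or.inl hxle)
        · exact hF x hx y hy
    · intro x hx
      rw [Finset.mem_insert, Finset.mem_insert] at hx
      rw [Finset.cons_eq_insert]
      rcases hx with rfl | rfl | hx
      · simp
      · simp
      · exact ⟨(hsub x hx).1, (hsub x hx).2.trans (Finset.subset_insert a s)⟩
    · rw [Finset.card_insert_of_notMem h2, Finset.card_insert_of_notMem h1, Finset.card_cons]
      omega

/-! ### Shortest paths -/

section ShortestPaths

variable {V : Type*} {G : SimpleGraph V}

theorem onShortestPath_of_walk {u w v : V} (p : G.Walk u w) (hp : p.length ≤ G.dist u w)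
    (hv : v ∈ p.support) : OnShortestPath G u w v := by
  have h : p.length = G.dist u w := le_antisymm hp (SimpleGraph.dist_le p)
  exact ⟨p, p.isPath_of_length_eq_dist h, h, hv⟩

theorem onShortestPath_end (hG : G.Connected) (u w : V) : OnShortestPath G u w w := by
  obtain ⟨p, hp⟩ := hG.exists_walk_length_eq_dist u w
  exact onShortestPath_of_walk p hp.le p.end_mem_support

/-- The successor of `v` on the path serves as `z`: were it no farther from `u` than `v` is, the
path could be shortened. -/
theorem OnShortestPath.exists_adj_dist_lt (hG : G.Connected) {u w v : V}
    (h : OnShortestPath G u w v) (hvw : v ≠ w) : ∃ z, G.Adj v z ∧ G.dist u v < G.dist u z := by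
  classical
  obtain ⟨p, -, hlen, hv⟩ := h
  have h1 := congrArg SimpleGraph.Walk.length (p.take_spec hv)
  rw [SimpleGraph.Walk.length_append] at h1
  have h2 := SimpleGraph.dist_le (p.takeUntil v hv)
  cases hq : p.dropUntil v hv with
  | nil => exact absurd rfl hvw
  | @cons _ z _ hz q =>
    refine ⟨z, hz, ?_⟩
    rw [hq, SimpleGraph.Walk.length_cons] at h1
    have h3 := SimpleGraph.dist_le q
    have h4 := hG.dist_triangle (u := u) (v := z) (w := w)
    omega

theorem two_le_dist (hG : G.Connected) {u v : V} (hne : u ≠ v) (hadj : ¬ G.Adj u v) :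
    2 ≤ G.dist u v := by
  have h1 := hG.pos_dist_of_ne hne
  have h2 : G.dist u v ≠ 1 := fun h => hadj (SimpleGraph.dist_eq_one_iff_adj.1 h)
  omega

theorem three_le_dist (hG : G.Connected) {u v : V} (hne : u ≠ v) (hadj : ¬ G.Adj u v)
    (hcommon : ∀ z, G.Adj u z → ¬ G.Adj z v) : 3 ≤ G.dist u v := by
  have h1 := two_le_dist hG hne hadj
  have h2 : G.dist u v ≠ 2 := by
    intro h
    obtain ⟨p, hp⟩ := hG.exists_walk_length_eq_dist u v
    rw [h] at hp
    match p, hp with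
    | .cons ha (.cons hb .nil), _ => exact hcommon _ ha hb
  omega

end ShortestPaths

/-! ### The zero-divisor graph of a blow-up -/

section Base

variable {L : Type*}

/-- The element of `L` whose chain contains a given element of the blow-up. -/
def Blowup.base [PartialOrder L] [BoundedOrder L] {k : ChainSizes L} (a : Blowup k) : L :=
  (ofLex a).1

theorem Blowup.base_le_base [PartialOrder L] [BoundedOrder L] {k : ChainSizes L} {a b : Blowup k}
    (h : a ≤ b) : a.base ≤ b.base := by
  obtain ⟨x, i⟩ := a
  obtain ⟨y, j⟩ := b
  rcases Blowup.mk_le_mk_iff.1 h with h | ⟨h, -⟩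
  · exact h.le
  · exact h.le

theorem Blowup.base_eq_bot_iff [PartialOrder L] [BoundedOrder L] {k : ChainSizes L}
    {a : Blowup k} : a.base = ⊥ ↔ a = ⊥ := by
  constructor
  · obtain ⟨x, i⟩ := a
    intro h
    refine le_bot_iff.1 (Blowup.mk_le_mk_iff.2 (Or.inr ⟨h, ?_⟩))
    have h' : x = ⊥ := h
    have hi := i.2
    have hs : k.size x = 1 := by rw [h', k.size_bot]
    change (i : ℕ) ≤ 0
    omega
  · rintro rfl
    rfl

theorem Blowup.lowerBounds_eq_iff [BooleanAlgebra L] {k : ChainSizes L} {a b : Blowup k} :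
    lowerBounds {a, b} = {⊥} ↔ Disjoint a.base b.base := by
  constructor
  · intro h
    -- The lowest element over the meet is a common lower bound even when the meet equals one of the
    -- two bases.
    let c : Blowup k := Blowup.mk (a.base ⊓ b.base) ⟨0, k.size_pos _⟩
    have hc : ∀ d : Blowup k, a.base ⊓ b.base ≤ d.base → c ≤ d := by
      rintro ⟨y, j⟩ hd
      refine Blowup.mk_le_mk_iff.2 ?_
      rcases hd.lt_or_eq with h | h
      · exact Or.inl h
      · exact Or.inr ⟨h, Nat.zero_le _⟩
    have hmem : c ∈ lowerBounds {a, b} := by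
      rintro d (rfl | rfl)
      · exact hc _ inf_le_left
      · exact hc _ inf_le_right
    rw [h] at hmem
    exact disjoint_iff.2 (Blowup.base_eq_bot_iff.2 hmem)
  · intro h
    refine Set.eq_singleton_iff_unique_mem.2 ⟨fun _ _ => bot_le, fun c hc => ?_⟩
    exact Blowup.base_eq_bot_iff.1 (le_bot_iff.1 (h
      (Blowup.base_le_base (hc (Set.mem_insert _ _)))
      (Blowup.base_le_base (hc (Set.mem_insert_of_mem _ rfl)))))

variable [BooleanAlgebra L] {k : ChainSizes L}

/-- The element of `L` whose chain contains a given vertex. -/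
def vertexBase (v : nonzeroZeroDivisors (Blowup k)) : L := (v : Blowup k).base

theorem zeroDivisorGraph_adj {u v : nonzeroZeroDivisors (Blowup k)} :
    (zeroDivisorGraph (Blowup k)).Adj u v ↔ Disjoint (vertexBase u) (vertexBase v) :=
  Blowup.lowerBounds_eq_iff

theorem vertexBase_ne_bot (v : nonzeroZeroDivisors (Blowup k)) : vertexBase v ≠ ⊥ :=
  fun h => v.2.2 (Blowup.base_eq_bot_iff.1 h)

theorem vertexBase_ne_top (v : nonzeroZeroDivisors (Blowup k)) : vertexBase v ≠ ⊤ := by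
  obtain ⟨b, hb, h⟩ := v.2.1
  intro hv
  have h' : Disjoint (vertexBase v) b.base := Blowup.lowerBounds_eq_iff.1 h
  rw [hv, top_disjoint] at h'
  exact hb (Blowup.base_eq_bot_iff.1 h')

theorem exists_vertexBase_eq {x : L} (h0 : x ≠ ⊥) (h1 : x ≠ ⊤) :
    ∃ v : nonzeroZeroDivisors (Blowup k), vertexBase v = x := by
  refine ⟨⟨Blowup.mk x ⟨0, k.size_pos x⟩, ⟨Blowup.mk xᶜ ⟨0, k.size_pos _⟩, ?_, ?_⟩, ?_⟩, rfl⟩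
  · exact fun h => h1 (compl_eq_bot.1 (Blowup.base_eq_bot_iff.2 h))
  · exact Blowup.lowerBounds_eq_iff.2 disjoint_compl_right
  · exact fun h => h0 (Blowup.base_eq_bot_iff.2 h)

theorem exists_vertexBase_eq_compl (v : nonzeroZeroDivisors (Blowup k)) :
    ∃ w : nonzeroZeroDivisors (Blowup k), vertexBase w = (vertexBase v)ᶜ :=
  exists_vertexBase_eq (fun h => vertexBase_ne_top v (compl_eq_bot.1 h))
    (fun h => vertexBase_ne_bot v (compl_eq_top.1 h))

/-- A vertex over the complement of the join is adjacent to both. -/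
theorem exists_walk_length_le_two {u v : nonzeroZeroDivisors (Blowup k)}
    (h : vertexBase u ⊔ vertexBase v ≠ ⊤) :
    ∃ p : (zeroDivisorGraph (Blowup k)).Walk u v, p.length ≤ 2 := by
  obtain ⟨z, hz⟩ := exists_vertexBase_eq (k := k) (x := (vertexBase u ⊔ vertexBase v)ᶜ)
    (fun h' => h (compl_eq_bot.1 h'))
    (fun h' => vertexBase_ne_bot u (sup_eq_bot_iff.1 (compl_eq_top.1 h')).1)
  have h1 : (zeroDivisorGraph (Blowup k)).Adj u z :=
    zeroDivisorGraph_adj.2 (hz ▸ disjoint_compl_right.mono_left le_sup_left)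
  have h2 : (zeroDivisorGraph (Blowup k)).Adj z v :=
    zeroDivisorGraph_adj.2 (hz ▸ disjoint_compl_left.mono_right le_sup_right)
  exact ⟨.cons h1 (.cons h2 .nil), le_rfl⟩

/-- When the join is `⊤` the complements are disjoint, which gives the walk `u, uᶜ, vᶜ, v`. -/
theorem exists_walk_length_le_three (u v : nonzeroZeroDivisors (Blowup k)) :
    ∃ p : (zeroDivisorGraph (Blowup k)).Walk u v, p.length ≤ 3 := by
  by_cases h : vertexBase u ⊔ vertexBase v = ⊤
  · obtain ⟨u', hu⟩ := exists_vertexBase_eq_compl u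
    obtain ⟨v', hv⟩ := exists_vertexBase_eq_compl v
    have h1 : (zeroDivisorGraph (Blowup k)).Adj u u' :=
      zeroDivisorGraph_adj.2 (hu ▸ disjoint_compl_right)
    have h2 : (zeroDivisorGraph (Blowup k)).Adj u' v' := by
      rw [zeroDivisorGraph_adj, hu, hv, disjoint_iff, ← compl_sup, h, compl_top]
    have h3 : (zeroDivisorGraph (Blowup k)).Adj v' v :=
      zeroDivisorGraph_adj.2 (hv ▸ disjoint_compl_left)
    exact ⟨.cons h1 (.cons h2 (.cons h3 .nil)), le_rfl⟩
  · obtain ⟨p, hp⟩ := exists_walk_length_le_two h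
    exact ⟨p, hp.trans (by norm_num)⟩

theorem zeroDivisorGraph_connected [Nonempty (nonzeroZeroDivisors (Blowup k))] :
    (zeroDivisorGraph (Blowup k)).Connected :=
  ⟨fun u v => (exists_walk_length_le_three u v).elim fun p _ => p.reachable⟩

/-- A vertex on a shortest path from `u`, other than the end of the path, has its base disjoint
from or strictly comparable to the base of `u`. -/
theorem OnShortestPath.disjoint_or_le {u v w : nonzeroZeroDivisors (Blowup k)}
    (h : OnShortestPath (zeroDivisorGraph (Blowup k)) u w v) (huv : u ≠ v) (hvw : v ≠ w) :
    vertexBase u ≠ vertexBase v ∧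
      (Disjoint (vertexBase u) (vertexBase v) ∨ vertexBase v ≤ vertexBase u) := by
  have : Nonempty (nonzeroZeroDivisors (Blowup k)) := ⟨u⟩
  have hG := zeroDivisorGraph_connected (k := k)
  obtain ⟨z, hz, hd⟩ := h.exists_adj_dist_lt hG hvw
  constructor
  -- Equal bases have equal neighbourhoods, so `z` would be at distance 1 from `u`, no farther than
  -- `v`.
  · intro he
    have hadj : (zeroDivisorGraph (Blowup k)).Adj u z := by
      rw [zeroDivisorGraph_adj] at hz ⊢
      rwa [he]
    have h1 := hG.pos_dist_of_ne huv
    rw [SimpleGraph.dist_eq_one_iff_adj.2 hadj] at hd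
    omega
  · by_cases hdis : Disjoint (vertexBase u) (vertexBase v)
    · exact Or.inl hdis
    · right
      have h2 := two_le_dist hG huv (fun h => hdis (zeroDivisorGraph_adj.1 h))
      -- Here `z` is at distance at least 3 from `u`, which excludes a join below `⊤`. Being
      -- disjoint from `v` and codisjoint with `u`, `z` then forces `v ≤ u`.
      have htop : vertexBase u ⊔ vertexBase z = ⊤ := by
        by_contra hne
        obtain ⟨p, hp⟩ := exists_walk_length_le_two hne
        have := SimpleGraph.dist_le p
        omega
      exact (zeroDivisorGraph_adj.1 hz).le_of_codisjoint (codisjoint_iff.2 htop).symm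

/-- The elements outside a strong resolving set have different bases, which form a laminar
family. -/
theorem IsStrongResolvingSet.disjoint_or_le {W : Finset (nonzeroZeroDivisors (Blowup k))}
    (hW : IsStrongResolvingSet (zeroDivisorGraph (Blowup k)) W)
    {u v : nonzeroZeroDivisors (Blowup k)} (hu : u ∉ W) (hv : v ∉ W) (huv : u ≠ v) :
    vertexBase u ≠ vertexBase v ∧ (Disjoint (vertexBase u) (vertexBase v) ∨
      vertexBase u ≤ vertexBase v ∨ vertexBase v ≤ vertexBase u) := by
  obtain ⟨w, hw, h | h⟩ := hW u v huv
  · obtain ⟨h1, h2⟩ := h.disjoint_or_le huv (fun h => hv (h ▸ hw))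
    exact ⟨h1, h2.imp_right Or.inr⟩
  · obtain ⟨h1, h2⟩ := h.disjoint_or_le huv.symm (fun h => hu (h ▸ hw))
    exact ⟨h1.symm, h2.imp (fun h => h.symm) Or.inl⟩

/-- A chain `z < y` gives a shortest path of length three. -/
theorem exists_walk_of_lt {a c : nonzeroZeroDivisors (Blowup k)}
    (hca : vertexBase c < vertexBase a) {b d : nonzeroZeroDivisors (Blowup k)}
    (hb : vertexBase b = (vertexBase a)ᶜ) (hd : vertexBase d = (vertexBase c)ᶜ) :
    OnShortestPath (zeroDivisorGraph (Blowup k)) a d b ∧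
      OnShortestPath (zeroDivisorGraph (Blowup k)) a d c := by
  have : Nonempty (nonzeroZeroDivisors (Blowup k)) := ⟨a⟩
  have h1 : (zeroDivisorGraph (Blowup k)).Adj a b :=
    zeroDivisorGraph_adj.2 (hb ▸ disjoint_compl_right)
  have h2 : (zeroDivisorGraph (Blowup k)).Adj b c :=
    zeroDivisorGraph_adj.2 (hb ▸ disjoint_compl_left.mono_right hca.le)
  have h3 : (zeroDivisorGraph (Blowup k)).Adj c d :=
    zeroDivisorGraph_adj.2 (hd ▸ disjoint_compl_right)
  have hdist : 3 ≤ (zeroDivisorGraph (Blowup k)).dist a d := by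
    refine three_le_dist zeroDivisorGraph_connected ?_ ?_ ?_
    · rintro rfl
      rw [hd] at hca
      have := disjoint_compl_right.eq_bot_of_le hca.le
      exact vertexBase_ne_bot c this
    · rw [zeroDivisorGraph_adj, hd, disjoint_compl_right_iff]
      exact hca.not_ge
    -- A common neighbour would be disjoint from `a` and lie below `c`, which is below `a`.
    · intro z hz hz'
      rw [zeroDivisorGraph_adj] at hz hz'
      rw [hd, disjoint_compl_right_iff] at hz'
      exact vertexBase_ne_bot z (hz.symm.eq_bot_of_le (hz'.trans hca.le))
  let p : (zeroDivisorGraph (Blowup k)).Walk a d := .cons h1 (.cons h2 (.cons h3 .nil))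
  exact ⟨onShortestPath_of_walk p hdist (by simp [p]), onShortestPath_of_walk p hdist (by simp [p])⟩

/-- If `z < y` is a chain of proper elements and `y` belongs to a laminar family, then `zᶜ`
does not. -/
theorem IsLaminar.compl_notMem {F : Set L} (hF : IsLaminar F) {y z : L} (hy : y ∈ F)
    (hz0 : z ≠ ⊥) (hzy : z < y) (hy1 : y ≠ ⊤) : zᶜ ∉ F := by
  intro h
  rcases hF _ h y hy with h | h | h
  · rw [disjoint_compl_left_iff] at h
    exact hzy.not_ge h
  · have := sup_eq_right.2 (sup_le hzy.le h)
    rw [← this, sup_compl_eq_top, top_sup_eq] at hy1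
    exact hy1 rfl
  · exact hz0 (disjoint_compl_right.eq_bot_of_le (hzy.le.trans h))

/-- The pairs of vertices with bases in a laminar family are strongly resolved by vertices with
base outside of the family. -/
theorem exists_stronglyResolves {F : Set L} (hF : IsLaminar F)
    (hsplit : ∀ x : L, ∃ z, z ≠ ⊥ ∧ (z < x ∨ z < xᶜ))
    {u v : nonzeroZeroDivisors (Blowup k)} (hu : vertexBase u ∈ F) (hv : vertexBase v ∈ F)
    (huv : vertexBase u ≠ vertexBase v) :
    ∃ w, vertexBase w ∉ F ∧ StronglyResolves (zeroDivisorGraph (Blowup k)) w u v := by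
  have : Nonempty (nonzeroZeroDivisors (Blowup k)) := ⟨u⟩
  -- The path is `v, vᶜ, u, uᶜ`, with `w` over `uᶜ`.
  have key_lt : ∀ u v : nonzeroZeroDivisors (Blowup k), vertexBase v ∈ F →
      vertexBase u < vertexBase v →
      ∃ w, vertexBase w ∉ F ∧ OnShortestPath (zeroDivisorGraph (Blowup k)) v w u := by
    intro u v hv h
    obtain ⟨b, hb⟩ := exists_vertexBase_eq_compl v
    obtain ⟨d, hd⟩ := exists_vertexBase_eq_compl u
    refine ⟨d, ?_, (exists_walk_of_lt h hb hd).2⟩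
    rw [hd]
    exact hF.compl_notMem hv (vertexBase_ne_bot u) h (vertexBase_ne_top v)
  -- The path is `v, u = vᶜ, z, zᶜ`, with `w` over `zᶜ`.
  have key_compl : ∀ (u v : nonzeroZeroDivisors (Blowup k)) (z : L), vertexBase v ∈ F →
      vertexBase u = (vertexBase v)ᶜ → z ≠ ⊥ → z < vertexBase v →
      ∃ w, vertexBase w ∉ F ∧ OnShortestPath (zeroDivisorGraph (Blowup k)) v w u := by
    intro u v z hv he hz0 hz
    obtain ⟨c, rfl⟩ := exists_vertexBase_eq (k := k) hz0 hz.ne_top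
    obtain ⟨d, hd⟩ := exists_vertexBase_eq_compl c
    refine ⟨d, ?_, (exists_walk_of_lt hz he hd).1⟩
    rw [hd]
    exact hF.compl_notMem hv hz0 hz (vertexBase_ne_top v)
  -- The path is `u, v, vᶜ`, with `w` over `vᶜ`.
  have key_disj : ∀ u v : nonzeroZeroDivisors (Blowup k), Disjoint (vertexBase u) (vertexBase v) →
      vertexBase u ≠ (vertexBase v)ᶜ → (vertexBase v)ᶜ ∉ F →
      ∃ w, vertexBase w ∉ F ∧ OnShortestPath (zeroDivisorGraph (Blowup k)) u w v := by
    intro u v hd hne hF'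
    obtain ⟨w, hw⟩ := exists_vertexBase_eq_compl v
    have h1 : (zeroDivisorGraph (Blowup k)).Adj u v := zeroDivisorGraph_adj.2 hd
    have h2 : (zeroDivisorGraph (Blowup k)).Adj v w :=
      zeroDivisorGraph_adj.2 (hw ▸ disjoint_compl_right)
    refine ⟨w, hw ▸ hF', onShortestPath_of_walk (.cons h1 (.cons h2 .nil)) ?_ (by simp)⟩
    refine two_le_dist zeroDivisorGraph_connected ?_ ?_
    · rintro rfl
      exact hne hw
    · rw [zeroDivisorGraph_adj, hw, disjoint_compl_right_iff]
      exact fun h => vertexBase_ne_bot u (hd.eq_bot_of_le h)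
  rcases hF _ hu _ hv with h | h | h
  · by_cases hc : vertexBase u = (vertexBase v)ᶜ
    · obtain ⟨z, hz0, hz | hz⟩ := hsplit (vertexBase v)
      · obtain ⟨w, hw, h⟩ := key_compl u v z hv hc hz0 hz
        exact ⟨w, hw, Or.inr h⟩
      · obtain ⟨w, hw, h⟩ := key_compl v u z hu (by rw [hc, compl_compl]) hz0 (hc ▸ hz)
        exact ⟨w, hw, Or.inl h⟩
    · by_cases hv' : (vertexBase v)ᶜ ∈ F
      -- If `vᶜ` is in the family, `u < vᶜ` keeps `uᶜ` out of it, so the roles of `u` and `v` are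
      -- exchanged.
      · have hlt : vertexBase u < (vertexBase v)ᶜ := (le_compl_iff_disjoint_right.2 h).lt_of_ne hc
        have hu' : (vertexBase u)ᶜ ∉ F :=
          hF.compl_notMem hv' (vertexBase_ne_bot u) hlt
            (fun h => vertexBase_ne_bot v (compl_eq_top.1 h))
        obtain ⟨w, hw, h⟩ := key_disj v u h.symm (fun h' => hc (by rw [h', compl_compl])) hu'
        exact ⟨w, hw, Or.inr h⟩
      · obtain ⟨w, hw, h⟩ := key_disj u v h hc hv'
        exact ⟨w, hw, Or.inl h⟩
  · obtain ⟨w, hw, h⟩ := key_lt u v hv (h.lt_of_ne huv)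
    exact ⟨w, hw, Or.inr h⟩
  · obtain ⟨w, hw, h⟩ := key_lt v u hu (h.lt_of_ne huv.symm)
    exact ⟨w, hw, Or.inl h⟩

end Base

/-! ### The strong metric dimension -/

section Dimension

variable {L : Type*} [BooleanAlgebra L] {k : ChainSizes L}

theorem IsLaminar.map_orderIso {M : Type*} [BooleanAlgebra M] {F : Set L} (hF : IsLaminar F)
    (e : L ≃o M) : IsLaminar (e '' F) := by
  rintro _ ⟨x, hx, rfl⟩ _ ⟨y, hy, rfl⟩
  simpa using hF x hx y hy

theorem card_compl_le_of_isStrongResolvingSet [Fintype (nonzeroZeroDivisors (Blowup k))]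
    [DecidableEq (nonzeroZeroDivisors (Blowup k))] {n : ℕ} (hn : n ≠ 0)
    (e : L ≃o Finset (Fin n)) {W : Finset (nonzeroZeroDivisors (Blowup k))}
    (hW : IsStrongResolvingSet (zeroDivisorGraph (Blowup k)) W) : Wᶜ.card + 2 ≤ 2 * n := by
  have hne : (Finset.univ : Finset (Fin n)).Nonempty := ⟨⟨0, Nat.pos_of_ne_zero hn⟩, by simp⟩
  set F : Finset (Finset (Fin n)) := Wᶜ.image fun v => e (vertexBase v) with hFdef
  have hinj : F.card = Wᶜ.card := by
    refine Finset.card_image_of_injOn fun u hu v hv he => ?_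
    by_contra huv
    exact (hW.disjoint_or_le (by simpa using hu) (by simpa using hv) huv).1 (e.injective he)
  have htop : Finset.univ ∉ F := by
    intro h
    obtain ⟨v, -, hv⟩ := Finset.mem_image.1 h
    exact vertexBase_ne_top v ((map_eq_top_iff e).1 hv)
  -- The whole set is the base of no vertex; adjoining it turns the bound `2n - 1` into `2n - 2`.
  have hlam : IsLaminar ((insert Finset.univ F : Finset (Finset (Fin n))) : Set (Finset (Fin n))) := by
    intro x hx y hy
    simp only [Finset.coe_insert, Set.mem_insert_iff, Finset.mem_coe] at hx hy
    rcases hx with rfl | hx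
    · exact Or.inr (Or.inr (Finset.subset_univ y))
    rcases hy with rfl | hy
    · exact Or.inr (Or.inl (Finset.subset_univ x))
    obtain ⟨u, hu, rfl⟩ := Finset.mem_image.1 hx
    obtain ⟨v, hv, rfl⟩ := Finset.mem_image.1 hy
    by_cases huv : u = v
    · exact Or.inr (Or.inl (huv ▸ le_rfl))
    · simpa using (hW.disjoint_or_le (by simpa using hu) (by simpa using hv) huv).2
  have := hlam.card_add_one_le Finset.univ hne _ (fun x hx => by
    refine ⟨?_, Finset.subset_univ x⟩
    rcases Finset.mem_insert.1 hx with rfl | hx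
    · exact hne
    · obtain ⟨u, hu, rfl⟩ := Finset.mem_image.1 hx
      exact Finset.nonempty_iff_ne_empty.2 fun h =>
        vertexBase_ne_bot u ((map_eq_bot_iff e).1 h))
  rw [Finset.card_insert_of_notMem htop, hinj, Finset.card_univ, Fintype.card_fin] at this
  omega

/-- As `n ≥ 3`, a set or its complement has at least two elements, hence properly contains a
singleton. This resolves complementary pairs. -/
theorem exists_ne_bot_lt_or_lt_compl {n : ℕ} (hn : 3 ≤ n) (e : L ≃o Finset (Fin n)) (x : L) :
    ∃ z, z ≠ ⊥ ∧ (z < x ∨ z < xᶜ) := by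
  have hlt : ∀ y : L, 1 < (e y).card → ∃ z, z ≠ ⊥ ∧ z < y := by
    intro y hy
    obtain ⟨i, hi⟩ := Finset.card_pos.1 (zero_lt_one.trans hy)
    refine ⟨e.symm {i}, ?_, ?_⟩
    · rw [Ne, map_eq_bot_iff]
      exact Finset.singleton_ne_empty i
    · rw [← e.lt_iff_lt, OrderIso.apply_symm_apply]
      refine (Finset.singleton_subset_iff.2 hi).lt_of_ne fun h => ?_
      rw [← h, Finset.card_singleton] at hy
      exact hy.ne rfl
  have hc : (e x).card + (e xᶜ).card = n := by
    rw [map_compl, Finset.card_add_card_compl, Fintype.card_fin]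
  by_cases h : 1 < (e x).card
  · obtain ⟨z, hz0, hz⟩ := hlt x h
    exact ⟨z, hz0, Or.inl hz⟩
  · obtain ⟨z, hz0, hz⟩ := hlt xᶜ (by omega)
    exact ⟨z, hz0, Or.inr hz⟩

theorem exists_isStrongResolvingSet [Fintype (nonzeroZeroDivisors (Blowup k))]
    [DecidableEq (nonzeroZeroDivisors (Blowup k))] {n : ℕ} (hn : 3 ≤ n)
    (e : L ≃o Finset (Fin n)) : ∃ W : Finset (nonzeroZeroDivisors (Blowup k)),
      IsStrongResolvingSet (zeroDivisorGraph (Blowup k)) W ∧ 2 * n ≤ Wᶜ.card + 2 := by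
  classical
  obtain ⟨F, hF, hsub, hcard⟩ := exists_isLaminar_card (Finset.univ : Finset (Fin n))
    ⟨⟨0, by omega⟩, by simp⟩
  have hex : ∀ x : F.erase Finset.univ,
      ∃ v : nonzeroZeroDivisors (Blowup k), vertexBase v = e.symm x := by
    rintro ⟨x, hx⟩
    rw [Finset.mem_erase] at hx
    refine exists_vertexBase_eq ?_ ?_
    · rw [Ne, map_eq_bot_iff]
      exact (hsub x hx.2).1.ne_empty
    · rw [Ne, map_eq_top_iff]
      exact hx.1
  choose s hs using hex
  have hsinj : Function.Injective s := fun x y h =>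
    Subtype.ext (e.symm.injective (by rw [← hs, ← hs, h]))
  -- Only one vertex over each member is left out, so any vertex whose base is outside the family is
  -- in this set.
  refine ⟨(Finset.univ.image s)ᶜ, ?_, ?_⟩
  · intro u v huv
    have hG := @zeroDivisorGraph_connected L _ k ⟨u⟩
    by_cases hu : u ∈ Finset.univ.image s
    · by_cases hv : v ∈ Finset.univ.image s
      · obtain ⟨x, -, rfl⟩ := Finset.mem_image.1 hu
        obtain ⟨y, -, rfl⟩ := Finset.mem_image.1 hv
        have hmem : ∀ x, vertexBase (s x) ∈ e.symm '' (F.erase Finset.univ : Finset _) :=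
          fun x => ⟨x, x.2, (hs x).symm⟩
        obtain ⟨w, hw, h⟩ := exists_stronglyResolves (k := k)
          ((hF.subset (Finset.coe_subset.2 (Finset.erase_subset Finset.univ F))).map_orderIso
            e.symm)
          (exists_ne_bot_lt_or_lt_compl hn e) (hmem x) (hmem y)
          (fun h => huv (congrArg s (Subtype.ext (e.symm.injective (by rw [← hs, ← hs, h])))))
        refine ⟨w, ?_, h⟩
        rw [Finset.mem_compl]
        intro hw'
        obtain ⟨z, -, rfl⟩ := Finset.mem_image.1 hw'
        exact hw (hmem z)
      · exact ⟨v, Finset.mem_compl.2 hv, Or.inl (onShortestPath_end hG u v)⟩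
    · exact ⟨u, Finset.mem_compl.2 hu, Or.inr (onShortestPath_end hG v u)⟩
  · rw [compl_compl, Finset.card_image_of_injective _ hsinj, Finset.card_univ, Fintype.card_coe]
    have := Finset.pred_card_le_card_erase (s := F) (a := Finset.univ)
    rw [Finset.card_univ, Fintype.card_fin] at hcard
    omega

/-- Boolean functions on a finite type are the same as finite subsets. -/
def boolFunctionOrderIso (ι : Type*) [Fintype ι] [DecidableEq ι] : (ι → Bool) ≃o Finset ι where
  toFun f := Finset.univ.filter fun i => f i = true
  invFun s i := decide (i ∈ s)
  left_inv f := by ext i; simp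
  right_inv s := by ext i; simp
  map_rel_iff' := by
    intro f g
    simp [Finset.subset_iff, Pi.le_def, Bool.le_iff_imp]

end Dimension

theorem mainTheorem1 {L : Type*} [BooleanAlgebra L] (n : ℕ) (hn : 3 ≤ n)
    (e : L ≃o (Fin n → Bool)) (k : ChainSizes L) (m : ℕ)
    (hm : {q : Blowup k | IsAtom q ∧ (annihilatorClass q).ncard = 1}.ncard = m) :
    (strongMetricDim (zeroDivisorGraph (Blowup k)) : ℤ) =
      ((nonzeroZeroDivisors (Blowup k)).ncard : ℤ) - 2 * n + 2 := by
  classical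
  let e' : L ≃o Finset (Fin n) := e.trans (boolFunctionOrderIso (Fin n))
  have : Finite L := Finite.of_equiv _ e'.toEquiv.symm
  have : Finite (Blowup k) := inferInstanceAs (Finite (Σ x : L, Fin (k.size x)))
  have : Fintype (nonzeroZeroDivisors (Blowup k)) := Fintype.ofFinite _
  have hV : (nonzeroZeroDivisors (Blowup k)).ncard
      = Fintype.card (nonzeroZeroDivisors (Blowup k)) := by
    rw [← Nat.card_coe_set_eq, Nat.card_eq_fintype_card]
  obtain ⟨W, hW, hWcard⟩ := exists_isStrongResolvingSet (k := k) hn e'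
  have hle : strongMetricDim (zeroDivisorGraph (Blowup k)) ≤ W.card := Nat.sInf_le ⟨W, hW, rfl⟩
  -- The infimum is attained, since `W` shows that the set of cardinalities is nonempty.
  obtain ⟨W', hW', hmin⟩ := Nat.sInf_mem (s := {c | ∃ W : Finset (nonzeroZeroDivisors (Blowup k)),
    IsStrongResolvingSet (zeroDivisorGraph (Blowup k)) W ∧ W.card = c}) ⟨_, W, hW, rfl⟩
  change W'.card = strongMetricDim (zeroDivisorGraph (Blowup k)) at hmin
  have h1 := card_compl_le_of_isStrongResolvingSet (by omega) e' hW'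
  have h2 := Finset.card_add_card_compl W
  have h3 := Finset.card_add_card_compl W'
  omega
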